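/- Let $0<p<1$ and let $X$ be a real random variable with mean zero and variance $\sigma^2$ that is sub-gaussian, i.e. $\sup_{q\ge 1} q^{-1/2}(\mathbb{E}|X|^q)^{1/q}<\infty$, the supremum being over real $q\ge 1$. For each $n\ge 1$ let $G_n$ be an Erdős–Rényi–Gilbert random graph $\mathcal{G}(n,p)$, that is, a simple graph on $n$ labeled vertices in which each of the $\binom n2$ pairs of vertices is joined by an edge independently with probability $p$; let $s_1\ge s_2\ge\cdots\ge s_n$ be the singular values (with multiplicity) of its $n\times n$ adjacency matrix; and let $X_1,\dots,X_n$ be i.i.d. random variables with the distribution of $X$, independent of $G_n$. Then, as $n\to\infty$, $$W_n(\boldsymbol{s})=\frac1n\sum_{j=1}^n s_jX_j\ \longrightarrow\ pX+N_p\quad\text{in distribution},$$ where $N_p$ is a normal random variable, independent of $pX$, with mean zero and variance $p(1-p)\sigma^2$ (the point mass at $0$ if $\sigma=0$). -/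

import Mathlib

open MeasureTheory ProbabilityTheory Filter

noncomputable section

/-- The sub-gaussian norm `‖X‖_ψ₂ = sup_{q ≥ 1} q^(-1/2) ‖X‖_q`, as an extended nonnegative real
(the supremum runs over all real exponents `q ≥ 1`). -/
def subgaussianNorm {Ω : Type*} [MeasurableSpace Ω] (X : Ω → ℝ) (μ : Measure Ω) : ENNReal :=
  ⨆ (q : ℝ) (_ : 1 ≤ q), eLpNorm X (ENNReal.ofReal q) μ / ENNReal.ofReal (Real.sqrt q)

/-- `X` is a sub-gaussian random variable: it is measurable (up to a null set) and its sub-gaussian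
norm is finite, i.e. `‖X‖_q ≤ K √q` for all real `q ≥ 1`, with a finite constant `K`. -/
def IsSubgaussian {Ω : Type*} [MeasurableSpace Ω] (X : Ω → ℝ) (μ : Measure Ω) : Prop :=
  AEMeasurable X μ ∧ subgaussianNorm X μ < ⊤

open scoped Classical in
/-- The singular spectrum `s₁ ≥ s₂ ≥ ⋯ ≥ sₙ` of a simple graph of order `n`: the singular values,
with multiplicity and in non-increasing order, of its real adjacency matrix, acting on Euclidean
space. The index `i : Fin n` is zero-based. -/
def singularSpectrum {n : ℕ} (G : SimpleGraph (Fin n)) (i : Fin n) : ℝ :=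
  (Matrix.toEuclideanLin (G.adjMatrix ℝ)).singularValues i

/-- The normalized weighted sum `(1/n) ∑ⱼ aⱼ xⱼ`. -/
def normalizedSum {n : ℕ} (a x : Fin n → ℝ) : ℝ :=
  (1 / (n : ℝ)) * ∑ j, a j * x j

end

/- The singular spectrum of a binomial random graph is dominated by its top value `≈ p n`, the others
being `o(n)`; a fourth moment (four-cycle) count shows this, and Lévy's theorem concludes. -/

/-! Given the graph, `W_n` has characteristic function `∏ φ(t sᵢ/n)`, where `φ` is that of `X`, so
everything depends on the normalised singular values `sᵢ/n`. Their squares sum to the edge density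
`d`, their fourth powers sum to the density of closed 4-walks, and the largest is at least `d`.

Counting four-cycles bounds the expected fourth moment by `p⁴ + 2/n`, so the nonnegative excess of
that moment over `d⁴` tends to 0 in mean. The same count gives `d → p` in mean square. If the excess
is small and `d` is near `p`, the top value is near `p`, every other value is small, and the squares
of the others sum to about `p - p²` (`spectrum_close_of_quarticDefect_le`).

The top factor then tends to `φ(tp)`. The many small factors merge, as in the central limit theorem,
into `exp(-σ²t²p(1-p)/2)` (`exists_norm_prod_charFun_sub_le`). Averaging over the graph and Lévy's
continuity theorem finish the proof. -/

section SingularValues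

/-! ### Singular values: moments as traces, and the operator norm bound. -/

open Module InnerProductSpace

variable {E F : Type*} [NormedAddCommGroup E] [InnerProductSpace ℝ E] [FiniteDimensional ℝ E]
  [NormedAddCommGroup F] [InnerProductSpace ℝ F] [FiniteDimensional ℝ F]

theorem LinearMap.sum_singularValues_sq (T : E →ₗ[ℝ] F) {n : ℕ} (hn : finrank ℝ E = n) :
    ∑ i : Fin n, T.singularValues i ^ 2 = LinearMap.trace ℝ E (T.adjoint ∘ₗ T) := by
  rw [T.isSymmetric_adjoint_comp_self.trace_eq_sum_eigenvalues hn]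
  simp [T.sq_singularValues_fin hn]

theorem LinearMap.sum_singularValues_pow_four (T : E →ₗ[ℝ] F) {n : ℕ} (hn : finrank ℝ E = n) :
    ∑ i : Fin n, T.singularValues i ^ 4 =
      LinearMap.trace ℝ E ((T.adjoint ∘ₗ T) ∘ₗ (T.adjoint ∘ₗ T)) := by
  have hS := T.isSymmetric_adjoint_comp_self
  rw [LinearMap.trace_eq_sum_inner _ (hS.eigenvectorBasis hn)]
  refine Finset.sum_congr rfl fun i _ ↦ ?_
  have h := hS.apply_eigenvectorBasis hn i
  rw [LinearMap.comp_apply, h, map_smul, h, ← T.sq_singularValues_fin hn]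
  simp [inner_smul_right]
  ring

theorem LinearMap.norm_apply_le_singularValues_zero (T : E →ₗ[ℝ] F) (v : E) :
    ‖T v‖ ≤ T.singularValues 0 * ‖v‖ := by
  have hS := T.isSymmetric_adjoint_comp_self
  refine le_of_sq_le_sq ?_ (mul_nonneg (T.singularValues_nonneg 0) (norm_nonneg v))
  let b := hS.eigenvectorBasis rfl
  have h1 : ‖T v‖ ^ 2 = inner ℝ ((T.adjoint ∘ₗ T) v) v := by
    rw [LinearMap.comp_apply, LinearMap.adjoint_inner_left, real_inner_self_eq_norm_sq]
  rw [h1, ← b.sum_inner_mul_inner, mul_pow, ← b.sum_sq_norm_inner_right v, Finset.mul_sum]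
  refine Finset.sum_le_sum fun i _ ↦ ?_
  rw [hS v (b i), hS.apply_eigenvectorBasis rfl i, ← T.sq_singularValues_fin rfl i,
    inner_smul_right, real_inner_comm v, Real.norm_eq_abs, sq_abs]
  have h2 : T.singularValues i ^ 2 ≤ T.singularValues 0 ^ 2 :=
    pow_le_pow_left₀ (T.singularValues_nonneg _) (T.singularValues_antitone (Nat.zero_le _)) 2
  have h3 := mul_le_mul_of_nonneg_right h2 (sq_nonneg (inner ℝ v (b i)))
  rw [pow_two (inner ℝ v (b i)), ← mul_assoc, ← mul_assoc] at h3
  simpa [b, pow_two, mul_assoc] using h3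

end SingularValues

/-! ### Moments of the singular spectrum as walk counts. -/

section Graph

open scoped Matrix

open scoped Classical in
theorem trace_adjMatrix_sq {n : ℕ} (G : SimpleGraph (Fin n)) :
    (G.adjMatrix ℝ * G.adjMatrix ℝ).trace = ∑ i, ∑ j, G.adjMatrix ℝ i j := by
  simp only [Matrix.trace, Matrix.diag_apply, Matrix.mul_apply]
  refine Finset.sum_congr rfl fun i _ ↦ Finset.sum_congr rfl fun j _ ↦ ?_
  by_cases h : G.Adj i j <;> simp [SimpleGraph.adjMatrix_apply, G.adj_comm j i, h]

open scoped Classical in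
theorem adjoint_comp_toEuclideanLin_adjMatrix {n : ℕ} (G : SimpleGraph (Fin n)) :
    (Matrix.toEuclideanLin (G.adjMatrix ℝ)).adjoint ∘ₗ Matrix.toEuclideanLin (G.adjMatrix ℝ) =
      Matrix.toEuclideanLin (G.adjMatrix ℝ * G.adjMatrix ℝ) := by
  rw [← Matrix.toEuclideanLin_conjTranspose_eq_adjoint, Matrix.conjTranspose_eq_transpose_of_trivial,
    SimpleGraph.transpose_adjMatrix]
  ext v i
  simp [Matrix.toLpLin_apply]

theorem trace_toEuclideanLin {n : ℕ} (A : Matrix (Fin n) (Fin n) ℝ) :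
    LinearMap.trace ℝ _ (Matrix.toEuclideanLin A) = A.trace := by
  rw [LinearMap.trace_eq_sum_inner _ (EuclideanSpace.basisFun (Fin n) ℝ)]
  simp [Matrix.trace, Matrix.toLpLin_apply, EuclideanSpace.inner_single_left]

open scoped Classical in
theorem sum_singularSpectrum_sq {n : ℕ} (G : SimpleGraph (Fin n)) :
    ∑ i, singularSpectrum G i ^ 2 = ∑ i, ∑ j, G.adjMatrix ℝ i j := by
  unfold singularSpectrum
  rw [LinearMap.sum_singularValues_sq _ finrank_euclideanSpace_fin,
    adjoint_comp_toEuclideanLin_adjMatrix, trace_toEuclideanLin, trace_adjMatrix_sq]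

open scoped Classical in
theorem sum_singularSpectrum_pow_four {n : ℕ} (G : SimpleGraph (Fin n)) :
    ∑ i, singularSpectrum G i ^ 4 = ∑ i, ∑ j, ∑ k, ∑ l,
      G.adjMatrix ℝ i j * G.adjMatrix ℝ j k * (G.adjMatrix ℝ k l * G.adjMatrix ℝ l i) := by
  unfold singularSpectrum
  rw [LinearMap.sum_singularValues_pow_four _ finrank_euclideanSpace_fin,
    adjoint_comp_toEuclideanLin_adjMatrix]
  have h : Matrix.toEuclideanLin (G.adjMatrix ℝ * G.adjMatrix ℝ) ∘ₗ
      Matrix.toEuclideanLin (G.adjMatrix ℝ * G.adjMatrix ℝ) = Matrix.toEuclideanLin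
        ((G.adjMatrix ℝ * G.adjMatrix ℝ) * (G.adjMatrix ℝ * G.adjMatrix ℝ)) := by
    ext v i
    simp [Matrix.toLpLin_apply]
  rw [h, trace_toEuclideanLin]
  simp only [Matrix.trace, Matrix.diag_apply, Matrix.mul_apply, Finset.sum_mul_sum]
  exact Finset.sum_congr rfl fun i _ ↦ Finset.sum_comm

open scoped Classical in
-- Test the quadratic form on the all-ones vector, whose squared norm is `n`.
theorem sum_adjMatrix_le_singularSpectrum {n : ℕ} (G : SimpleGraph (Fin n)) (hn : 0 < n) :
    ∑ i, ∑ j, G.adjMatrix ℝ i j ≤ n * singularSpectrum G ⟨0, hn⟩ := by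
  set T := Matrix.toEuclideanLin (G.adjMatrix ℝ)
  set v : EuclideanSpace ℝ (Fin n) := WithLp.toLp 2 fun _ ↦ 1
  have hv : ‖v‖ ^ 2 = n := by simp [v, EuclideanSpace.norm_sq_eq]
  have h : ∑ i, ∑ j, G.adjMatrix ℝ i j = inner ℝ v (T v) := by
    simp [T, v, Matrix.toLpLin_apply, PiLp.inner_apply, Matrix.mulVec, dotProduct]
  calc _ = inner ℝ v (T v) := h
    _ ≤ ‖v‖ * ‖T v‖ := real_inner_le_norm _ _
    _ ≤ ‖v‖ * (T.singularValues 0 * ‖v‖) :=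
      mul_le_mul_of_nonneg_left (T.norm_apply_le_singularValues_zero v) (norm_nonneg v)
    _ = ‖v‖ ^ 2 * T.singularValues 0 := by ring
    _ = _ := by rw [hv]; rfl

end Graph

/-! ### Expected edge and four-cycle counts. -/

section RandomGraph

instance SimpleGraph.instDiscreteMeasurableSpace {V : Type*} [Finite V] :
    DiscreteMeasurableSpace (SimpleGraph V) := by
  have : MeasurableSingletonClass (SimpleGraph V) := ⟨fun G ↦ by
    have h : ({G} : Set (SimpleGraph V)) = SimpleGraph.edgeSet ⁻¹' {G.edgeSet} := by
      ext H; simp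
    rw [h]
    exact SimpleGraph.measurable_edgeSet (Set.toFinite _).measurableSet⟩
  infer_instance

/-- The event is a cylinder for the underlying product Bernoulli measure. Diagonal pairs are
excluded because they never become edges. -/
theorem SimpleGraph.binomialRandom_superset {V : Type*} [Finite V] (p : unitInterval)
    (S : Finset (Sym2 V)) (hS : ∀ e ∈ S, ¬ e.IsDiag) :
    SimpleGraph.binomialRandom V p {G | ∀ e ∈ S, e ∈ G.edgeSet} =
      (unitInterval.toNNReal p : ENNReal) ^ S.card := by
  rw [SimpleGraph.binomialRandom_eq_map,
    Measure.map_apply SimpleGraph.measurable_fromEdgeSet (Set.toFinite _).measurableSet,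
    setBernoulli_apply']
  have h : ((fun q : Sym2 V → Prop ↦ {i | q i}) ⁻¹'
      (SimpleGraph.fromEdgeSet ⁻¹' {G | ∀ e ∈ S, e ∈ G.edgeSet})) =
      (S : Set (Sym2 V)).pi fun _ ↦ {True} := by
    ext q
    simp only [Set.mem_preimage, Set.mem_ofPred_eq, SimpleGraph.edgeSet_fromEdgeSet, Set.mem_pi,
      Finset.mem_coe, Set.mem_singleton_iff, eq_iff_iff, iff_true]
    refine forall₂_congr fun e he ↦ ?_
    simp [hS e he]
  rw [h, Measure.infinitePi_pi _ (fun _ _ ↦ measurableSet_singleton _)]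
  rw [Finset.prod_congr rfl (g := fun _ ↦ (unitInterval.toNNReal p : ENNReal)), Finset.prod_const]
  intro e he
  simp [hS e he]

open scoped Classical in
theorem SimpleGraph.integral_prod_mem_edgeSet {V : Type*} [Finite V] (p : unitInterval)
    (S : Finset (Sym2 V)) (hS : ∀ e ∈ S, ¬ e.IsDiag) :
    ∫ G, ∏ e ∈ S, (if e ∈ G.edgeSet then (1 : ℝ) else 0) ∂(SimpleGraph.binomialRandom V p) =
      (p : ℝ) ^ S.card := by
  have h : (fun G : SimpleGraph V ↦ ∏ e ∈ S, (if e ∈ G.edgeSet then (1 : ℝ) else 0)) =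
      {G : SimpleGraph V | ∀ e ∈ S, e ∈ G.edgeSet}.indicator 1 := by
    ext G
    simp only [Finset.prod_boole, Set.indicator_apply, Set.mem_ofPred_eq, Pi.one_apply]
  rw [h, integral_indicator_one (Set.toFinite _).measurableSet, measureReal_def,
    SimpleGraph.binomialRandom_superset p S hS]
  simp

variable {n : ℕ}

open scoped Classical in
theorem adjMatrix_eq_ite_mem_edgeSet (G : SimpleGraph (Fin n)) (i j : Fin n) :
    G.adjMatrix ℝ i j = if s(i, j) ∈ G.edgeSet then 1 else 0 := by
  simp [SimpleGraph.adjMatrix_apply]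

open scoped Classical in
theorem integral_adjMatrix (p : unitInterval) {i j : Fin n} (h : i ≠ j) :
    ∫ G, G.adjMatrix ℝ i j ∂(SimpleGraph.binomialRandom (Fin n) p) = p := by
  simpa [adjMatrix_eq_ite_mem_edgeSet] using
    SimpleGraph.integral_prod_mem_edgeSet p {s(i, j)} (by simpa using h)

open scoped Classical in
theorem adjMatrix_nonneg (G : SimpleGraph (Fin n)) (i j : Fin n) : 0 ≤ G.adjMatrix ℝ i j := by
  rw [SimpleGraph.adjMatrix_apply]; split_ifs <;> norm_num

open scoped Classical in
theorem adjMatrix_le_one (G : SimpleGraph (Fin n)) (i j : Fin n) : G.adjMatrix ℝ i j ≤ 1 := by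
  rw [SimpleGraph.adjMatrix_apply]; split_ifs <;> norm_num

open scoped Classical in
-- A loop makes the product vanish. Otherwise the four edges are distinct unless `i = k` or `j = l`,
-- where the trivial bound 1 suffices: such tuples contribute at most `2n³` of `n⁴`.
theorem integral_four_cycle_le (p : unitInterval) (i j k l : Fin n) :
    ∫ G, G.adjMatrix ℝ i j * G.adjMatrix ℝ j k * (G.adjMatrix ℝ k l * G.adjMatrix ℝ l i)
      ∂(SimpleGraph.binomialRandom (Fin n) p) ≤
      (p : ℝ) ^ 4 + (if i = k then 1 else 0) + (if j = l then 1 else 0) := by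
  have hp : (0 : ℝ) ≤ (p : ℝ) ^ 4 := pow_nonneg p.2.1 4
  by_cases hd : i = j ∨ j = k ∨ k = l ∨ l = i
  · have h0 (G : SimpleGraph (Fin n)) : G.adjMatrix ℝ i j * G.adjMatrix ℝ j k *
        (G.adjMatrix ℝ k l * G.adjMatrix ℝ l i) = 0 := by
      rcases hd with rfl | rfl | rfl | rfl <;> simp [SimpleGraph.adjMatrix_apply]
    simp only [h0, integral_zero]
    split_ifs <;> linarith
  by_cases he : i = k ∨ j = l
  · have h1 : ∫ G, G.adjMatrix ℝ i j * G.adjMatrix ℝ j k *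
        (G.adjMatrix ℝ k l * G.adjMatrix ℝ l i) ∂(SimpleGraph.binomialRandom (Fin n) p) ≤
        ∫ _, 1 ∂(SimpleGraph.binomialRandom (Fin n) p) := by
      refine integral_mono .of_finite .of_finite fun G ↦ ?_
      refine mul_le_one₀ (mul_le_one₀ ?_ ?_ ?_) (mul_nonneg ?_ ?_) (mul_le_one₀ ?_ ?_ ?_) <;>
        first | exact adjMatrix_nonneg _ _ _ | exact adjMatrix_le_one _ _ _
    simp only [integral_const, probReal_univ, smul_eq_mul, mul_one] at h1
    refine h1.trans ?_
    rcases he with h | h <;> rw [if_pos h] <;> split_ifs <;> linarith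
  · push Not at hd he
    obtain ⟨hij, hjk, hkl, hli⟩ := hd
    obtain ⟨hik, hjl⟩ := he
    have h1 := SimpleGraph.integral_prod_mem_edgeSet p
      {s(i, j), s(j, k), s(k, l), s(l, i)} (by simp [hij, hjk, hkl, hli])
    have hc : ({s(i, j), s(j, k), s(k, l), s(l, i)} : Finset (Sym2 (Fin n))).card = 4 := by
      rw [Finset.card_insert_of_notMem, Finset.card_insert_of_notMem,
        Finset.card_insert_of_notMem, Finset.card_singleton]
      all_goals simp; grind
    rw [hc] at h1
    rw [if_neg hik, if_neg hjl, add_zero, add_zero, ← h1]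
    refine (integral_congr_ae (.of_forall fun G ↦ ?_)).le
    rw [Finset.prod_insert, Finset.prod_insert, Finset.prod_insert, Finset.prod_singleton]
    · simp only [adjMatrix_eq_ite_mem_edgeSet]
      ring
    all_goals simp; grind

/-- The normalised number of ordered adjacent pairs of vertices. -/
noncomputable def edgeDensity (G : SimpleGraph (Fin n)) : ℝ :=
  (open scoped Classical in ∑ i, ∑ j, G.adjMatrix ℝ i j) / (n : ℝ) ^ 2

theorem edgeDensity_nonneg (G : SimpleGraph (Fin n)) : 0 ≤ edgeDensity G :=
  div_nonneg (Finset.sum_nonneg fun _ _ ↦ Finset.sum_nonneg fun _ _ ↦ adjMatrix_nonneg G _ _)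
    (by positivity)

theorem edgeDensity_le_one (G : SimpleGraph (Fin n)) : edgeDensity G ≤ 1 := by
  refine div_le_one_of_le₀ ?_ (by positivity)
  calc _ ≤ ∑ _i : Fin n, ∑ _j : Fin n, (1 : ℝ) :=
        Finset.sum_le_sum fun _ _ ↦ Finset.sum_le_sum fun _ _ ↦ adjMatrix_le_one G _ _
    _ = _ := by simp [pow_two]

theorem integral_edgeDensity (p : unitInterval) (hn : 0 < n) :
    ∫ G, edgeDensity G ∂(SimpleGraph.binomialRandom (Fin n) p) = p * (1 - 1 / n) := by
  classical
  have hn' : (n : ℝ) ≠ 0 := by positivity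
  unfold edgeDensity
  rw [integral_div, integral_finsetSum _ fun _ _ ↦ .of_finite]
  have h (i : Fin n) : ∫ G, ∑ j, G.adjMatrix ℝ i j ∂(SimpleGraph.binomialRandom (Fin n) p) =
      p * (n - 1) := by
    rw [integral_finsetSum _ fun _ _ ↦ .of_finite, ← Finset.sum_erase_add _ _ (Finset.mem_univ i),
      Finset.sum_congr rfl fun j hj ↦ integral_adjMatrix p (Finset.ne_of_mem_erase hj).symm]
    simp [Finset.card_erase_of_mem, Nat.cast_sub (Nat.succ_le_of_lt hn)]
    ring
  rw [Finset.sum_congr rfl fun i _ ↦ by convert h i]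
  simp
  field_simp

theorem integral_sum_singularSpectrum_pow_four_le (p : unitInterval) (hn : 0 < n) :
    ∫ G, ∑ i, (singularSpectrum G i / n) ^ 4 ∂(SimpleGraph.binomialRandom (Fin n) p) ≤
      (p : ℝ) ^ 4 + 2 / n := by
  classical
  have hn' : (0 : ℝ) < n := by positivity
  simp only [div_pow, ← Finset.sum_div, sum_singularSpectrum_pow_four]
  rw [integral_div, div_le_iff₀ (by positivity)]
  simp only [integral_finsetSum _ fun _ _ ↦ Integrable.of_finite]
  calc _ ≤ ∑ i : Fin n, ∑ j : Fin n, ∑ k : Fin n, ∑ l : Fin n,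
        ((p : ℝ) ^ 4 + (if i = k then 1 else 0) + (if j = l then 1 else 0)) := by
        gcongr with i _ j _ k _ l _
        exact integral_four_cycle_le p i j k l
    _ = ((p : ℝ) ^ 4 + 2 / n) * n ^ 4 := by
        simp [Finset.sum_add_distrib]
        field_simp
        ring

end RandomGraph

/-! ### Products of characteristic functions with one dominant factor. -/

section CharFun

open scoped Topology

theorem norm_prod_sub_prod_le_sum {ι : Type*} (s : Finset ι) (f g : ι → ℂ)
    (hf : ∀ i ∈ s, ‖f i‖ ≤ 1) (hg : ∀ i ∈ s, ‖g i‖ ≤ 1) :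
    ‖∏ i ∈ s, f i - ∏ i ∈ s, g i‖ ≤ ∑ i ∈ s, ‖f i - g i‖ := by
  classical
  induction s using Finset.induction_on with
  | empty => simp
  | insert a s ha ih =>
    rw [Finset.prod_insert ha, Finset.prod_insert ha, Finset.sum_insert ha]
    have h1 : ‖∏ i ∈ s, f i‖ ≤ 1 := by
      rw [norm_prod]
      exact Finset.prod_le_one (fun _ _ ↦ norm_nonneg _)
        fun i hi ↦ hf i (Finset.mem_insert_of_mem hi)
    have h2 := ih (fun i hi ↦ hf i (Finset.mem_insert_of_mem hi))
      (fun i hi ↦ hg i (Finset.mem_insert_of_mem hi))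
    have h3 := hg a (Finset.mem_insert_self a s)
    calc _ = ‖(f a - g a) * ∏ i ∈ s, f i + g a * (∏ i ∈ s, f i - ∏ i ∈ s, g i)‖ := by
          congr 1; ring
      _ ≤ ‖f a - g a‖ * ‖∏ i ∈ s, f i‖ + ‖g a‖ * ‖∏ i ∈ s, f i - ∏ i ∈ s, g i‖ := by
          rw [← norm_mul, ← norm_mul]; exact norm_add_le _ _
      _ ≤ ‖f a - g a‖ * 1 + 1 * ∑ i ∈ s, ‖f i - g i‖ := by gcongr
      _ = _ := by ring

/-- Both functions have second-order Taylor polynomial `1 - σ²t²/2` at 0. -/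
theorem charFun_sub_exp_isLittleO {Ω : Type*} [MeasurableSpace Ω] {P : Measure Ω}
    [IsProbabilityMeasure P] {X : Ω → ℝ} (hX : MemLp X 2 P) (h0 : ∫ ω, X ω ∂P = 0) {σ : ℝ}
    (h1 : ∫ ω, X ω ^ 2 ∂P = σ ^ 2) :
    (fun t : ℝ ↦ charFun (P.map X) t - Complex.exp (-(σ ^ 2 * t ^ 2 / 2))) =o[𝓝 0]
      fun t ↦ t ^ 2 := by
  have hm := hX.aestronglyMeasurable.aemeasurable
  have : IsProbabilityMeasure (P.map X) := Measure.isProbabilityMeasure_map hm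
  have hid : MemLp id 2 (P.map X) := (memLp_map_measure_iff (by fun_prop) hm).2 hX
  have hA := taylor_isLittleO_univ (x₀ := 0) (contDiff_charFun (n := 2) (μ := P.map X) hid)
  simp only [taylorWithinEval_charFun_two_zero hm hid, sub_zero, Pi.pow_apply, h0, h1] at hA
  have hE : (fun z : ℂ ↦ Complex.exp z - 1 - z) =o[𝓝 0] fun z ↦ z := by
    have := (Complex.hasDerivAt_exp 0).isLittleO
    simpa using this
  have ht : Tendsto (fun t : ℝ ↦ -((σ : ℂ) ^ 2 * (t : ℂ) ^ 2 / 2)) (𝓝 0) (𝓝 0) := by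
    have : Continuous fun t : ℝ ↦ -((σ : ℂ) ^ 2 * (t : ℂ) ^ 2 / 2) := by fun_prop
    simpa using this.tendsto 0
  have hB := hE.comp_tendsto ht
  have hO : ((fun z : ℂ ↦ z) ∘ fun t : ℝ ↦ -((σ : ℂ) ^ 2 * (t : ℂ) ^ 2 / 2)) =O[𝓝 0]
      fun t : ℝ ↦ t ^ 2 := by
    refine Asymptotics.IsBigO.of_bound (σ ^ 2 / 2) (.of_forall fun t ↦ ?_)
    simp
    exact le_of_eq (by ring)
  refine (hA.sub (hB.trans_isBigO hO)).congr_left fun t ↦ ?_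
  simp
  ring

theorem exists_norm_prod_charFun_sub_le {μ : Measure ℝ} [IsProbabilityMeasure μ] {σ : ℝ}
    (hμ : (fun t : ℝ ↦ charFun μ t - Complex.exp (-(σ ^ 2 * t ^ 2 / 2))) =o[𝓝 0]
      fun t ↦ t ^ 2) (t a v : ℝ) {η : ℝ} (hη : 0 < η) :
    ∃ ε > 0, ∀ {ι : Type} [Fintype ι] [DecidableEq ι] (u : ι → ℝ) (i₀ : ι),
      |u i₀ - a| ≤ ε → (∀ i ≠ i₀, |u i| ≤ ε) → |∑ i ∈ Finset.univ.erase i₀, u i ^ 2 - v| ≤ ε →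
      ‖∏ i, charFun μ (t * u i) -
        charFun μ (t * a) * Complex.exp (-(σ ^ 2 * t ^ 2 * v / 2))‖ ≤ η := by
  -- Taylor tolerance: the errors add up to at most `κ t² s`, with `s ≤ |v| + 1`, hence at most `η /
  -- 2`.
  set κ := η / 2 / (t ^ 2 * (|v| + 1) + 1)
  have hκ : 0 < κ := by positivity
  obtain ⟨δ, hδ, hδ'⟩ := Metric.eventually_nhds_iff.1 (hμ.def hκ)
  have hc : Continuous fun q : ℝ × ℝ ↦
      charFun μ (t * q.1) * Complex.exp (-(σ ^ 2 * t ^ 2 * q.2 / 2)) := by fun_prop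
  obtain ⟨ρ, hρ, hρ'⟩ := Metric.continuous_iff.1 hc (a, v) (η / 2) (by positivity)
  -- The three bounds serve continuity of the limit in `(a, v)`, keeping `t * u i` in the Taylor
  -- range, and `s ≤ |v| + 1`.
  refine ⟨min (min (ρ / 2) (δ / 2 / (|t| + 1))) 1, by positivity, ?_⟩
  intro ι _ _ u i₀ ha hu hv
  obtain ⟨⟨ha1, -⟩, -⟩ := by simpa only [le_min_iff] using ha
  obtain ⟨⟨hv1, -⟩, hv2⟩ := by simpa only [le_min_iff] using hv
  set s := ∑ i ∈ Finset.univ.erase i₀, u i ^ 2 with hs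
  have h1 : ‖charFun μ (t * u i₀) * Complex.exp (-(σ ^ 2 * t ^ 2 * s / 2)) -
      charFun μ (t * a) * Complex.exp (-(σ ^ 2 * t ^ 2 * v / 2))‖ < η / 2 := by
    rw [← dist_eq_norm]
    refine hρ' (u i₀, s) ?_
    rw [Prod.dist_eq, Real.dist_eq, Real.dist_eq]
    exact max_lt (by simp only; linarith) (by simp only; linarith)
  have h2 : Complex.exp (-(σ ^ 2 * t ^ 2 * s / 2)) = ∏ i ∈ Finset.univ.erase i₀,
      Complex.exp (-(σ ^ 2 * (t * u i : ℝ) ^ 2 / 2)) := by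
    rw [← Complex.exp_sum, hs]
    push_cast
    rw [Finset.mul_sum, Finset.sum_div, ← Finset.sum_neg_distrib]
    congr 1
    exact Finset.sum_congr rfl fun i _ ↦ by ring
  have h3 : ‖∏ i, charFun μ (t * u i) -
      charFun μ (t * u i₀) * Complex.exp (-(σ ^ 2 * t ^ 2 * s / 2))‖ ≤ η / 2 := by
    rw [← Finset.mul_prod_erase _ _ (Finset.mem_univ i₀), ← mul_sub, norm_mul, h2]
    calc _ ≤ 1 * ‖∏ i ∈ Finset.univ.erase i₀, charFun μ (t * u i) -
          ∏ i ∈ Finset.univ.erase i₀, Complex.exp (-(σ ^ 2 * (t * u i : ℝ) ^ 2 / 2))‖ := by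
          gcongr; exact norm_charFun_le_one _
      _ ≤ ∑ i ∈ Finset.univ.erase i₀, ‖charFun μ (t * u i) -
          Complex.exp (-(σ ^ 2 * (t * u i : ℝ) ^ 2 / 2))‖ := by
          rw [one_mul]
          refine norm_prod_sub_prod_le_sum _ _ _ (fun i _ ↦ norm_charFun_le_one _) fun i _ ↦ ?_
          rw [Complex.norm_exp, Real.exp_le_one_iff]
          norm_cast
          have : 0 ≤ σ ^ 2 * (t * u i) ^ 2 / 2 := by positivity
          linarith
      _ ≤ ∑ i ∈ Finset.univ.erase i₀, κ * (t * u i) ^ 2 := by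
          refine Finset.sum_le_sum fun i hi ↦ ?_
          have hi' := hu i (Finset.ne_of_mem_erase hi)
          obtain ⟨⟨-, h⟩, -⟩ := by simpa only [le_min_iff] using hi'
          have := @hδ' (t * u i) (by
            rw [Real.dist_eq, sub_zero, abs_mul]
            calc |t| * |u i| ≤ (|t| + 1) * (δ / 2 / (|t| + 1)) := by gcongr; linarith
              _ = δ / 2 := by field_simp
              _ < δ := by linarith)
          rwa [Real.norm_of_nonneg (sq_nonneg _)] at this
      _ = κ * (t ^ 2 * s) := by
          simp only [mul_pow, hs, Finset.mul_sum]
      _ ≤ κ * (t ^ 2 * (|v| + 1) + 1) := by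
          have : s ≤ |v| + 1 := by linarith [le_abs_self v, (abs_le.1 hv2).2]
          have := mul_le_mul_of_nonneg_left this (sq_nonneg t)
          gcongr
          linarith
      _ = η / 2 := by simp only [κ]; field_simp
  calc _ ≤ _ := norm_sub_le_norm_sub_add_norm_sub _
        (charFun μ (t * u i₀) * Complex.exp (-(σ ^ 2 * t ^ 2 * s / 2))) _
    _ ≤ η := by linarith

end CharFun

/-! ### Quasirandomness of the binomial random graph. -/

section Concentration

open scoped Topology

variable {n : ℕ}

theorem singularSpectrum_nonneg (G : SimpleGraph (Fin n)) (i : Fin n) : 0 ≤ singularSpectrum G i :=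
  LinearMap.singularValues_nonneg _ _

theorem sum_normalized_singularSpectrum_sq (G : SimpleGraph (Fin n)) :
    ∑ i, (singularSpectrum G i / n) ^ 2 = edgeDensity G := by
  simp only [div_pow, ← Finset.sum_div, sum_singularSpectrum_sq, edgeDensity]

theorem edgeDensity_le_singularSpectrum (G : SimpleGraph (Fin n)) (hn : 0 < n) :
    edgeDensity G ≤ singularSpectrum G ⟨0, hn⟩ / n := by
  have hn' : (0 : ℝ) < n := by positivity
  rw [edgeDensity, div_le_div_iff₀ (by positivity) hn']
  nlinarith [sum_adjMatrix_le_singularSpectrum G hn]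

/-- The excess of the normalised fourth moment of the singular spectrum over the fourth power of
the edge density; it is small precisely for quasirandom graphs. -/
noncomputable def quarticDefect (G : SimpleGraph (Fin n)) : ℝ :=
  ∑ i, (singularSpectrum G i / n) ^ 4 - edgeDensity G ^ 4

theorem top_add_singularSpectrum_le_quarticDefect (G : SimpleGraph (Fin n)) (hn : 0 < n)
    {i : Fin n} (hi : i ≠ ⟨0, hn⟩) :
    (singularSpectrum G ⟨0, hn⟩ / n) ^ 4 - edgeDensity G ^ 4 + (singularSpectrum G i / n) ^ 4 ≤
      quarticDefect G := by
  have h := Finset.sum_le_sum_of_subset_of_nonneg (Finset.subset_univ {⟨0, hn⟩, i})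
    (f := fun i ↦ (singularSpectrum G i / n) ^ 4) (fun i _ _ ↦ by positivity)
  rw [Finset.sum_pair hi.symm] at h
  unfold quarticDefect
  linarith

theorem top_le_quarticDefect (G : SimpleGraph (Fin n)) (hn : 0 < n) :
    (singularSpectrum G ⟨0, hn⟩ / n) ^ 4 - edgeDensity G ^ 4 ≤ quarticDefect G := by
  have h := Finset.single_le_sum (f := fun i ↦ (singularSpectrum G i / n) ^ 4)
    (fun i _ ↦ by positivity) (Finset.mem_univ ⟨0, hn⟩)
  unfold quarticDefect
  linarith

theorem quarticDefect_nonneg (G : SimpleGraph (Fin n)) : 0 ≤ quarticDefect G := by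
  rcases Nat.eq_zero_or_pos n with rfl | hn
  · simp [quarticDefect, edgeDensity]
  · have h := pow_le_pow_left₀ (edgeDensity_nonneg G) (edgeDensity_le_singularSpectrum G hn) 4
    linarith [top_le_quarticDefect G hn]

theorem spectrum_close_of_quarticDefect_le (G : SimpleGraph (Fin n)) (hn : 0 < n) {p ε : ℝ}
    (hp0 : 0 ≤ p) (hp1 : p ≤ 1) (hε : 0 ≤ ε) (hD : quarticDefect G ≤ ε ^ 4)
    (hd : |edgeDensity G - p| ≤ ε) :
    |singularSpectrum G ⟨0, hn⟩ / n - p| ≤ 2 * ε ∧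
    (∀ i ≠ (⟨0, hn⟩ : Fin n), |singularSpectrum G i / n| ≤ ε) ∧
    |∑ i ∈ Finset.univ.erase (⟨0, hn⟩ : Fin n), (singularSpectrum G i / n) ^ 2 - p * (1 - p)| ≤ 5 * ε := by
  set d := edgeDensity G
  have hd0 : 0 ≤ d := edgeDensity_nonneg G
  have hda := edgeDensity_le_singularSpectrum G hn
  have hsum := sum_normalized_singularSpectrum_sq G
  rw [← Finset.add_sum_erase _ _ (Finset.mem_univ (⟨0, hn⟩ : Fin n))] at hsum
  have htop := top_le_quarticDefect G hn
  have hother (i : Fin n) (hi : i ≠ ⟨0, hn⟩) := top_add_singularSpectrum_le_quarticDefect G hn hi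
  set a := singularSpectrum G ⟨0, hn⟩ / n
  have hda4 : d ^ 4 ≤ a ^ 4 := pow_le_pow_left₀ hd0 hda 4
  have had : a - d ≤ ε := by
    refine le_of_pow_le_pow_left₀ (n := 4) (by norm_num) hε ?_
    -- Superadditivity of `x⁴` on nonnegative reals turns the fourth-power gap into a bound on `a -
    -- d`.
    have h1 : (a - d) ^ 4 + d ^ 4 ≤ a ^ 4 := by
      have := pow_add_pow_le (x := a - d) (y := d) (by linarith) hd0 (n := 4) (by norm_num)
      simpa using this
    linarith
  rw [abs_le] at hd
  have h1 : |a - p| ≤ 2 * ε := by rw [abs_le]; constructor <;> linarith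
  refine ⟨h1, fun i hi ↦ ?_, ?_⟩
  · rw [abs_of_nonneg (div_nonneg (singularSpectrum_nonneg _ _) (by positivity))]
    refine le_of_pow_le_pow_left₀ (n := 4) (by norm_num) hε ?_
    have := hother i hi
    linarith
  · have hs : 0 ≤ ∑ i ∈ Finset.univ.erase (⟨0, hn⟩ : Fin n), (singularSpectrum G i / n) ^ 2 :=
      Finset.sum_nonneg fun _ _ ↦ by positivity
    have ha1 : a ≤ 1 := by
      have : a ^ 2 ≤ 1 := by linarith [edgeDensity_le_one G]
      nlinarith
    -- The remaining sum is `d - a²`; its error is at most `|d - p| + |a² - p²| ≤ ε + 2ε · 2`.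
    rw [eq_sub_of_add_eq' hsum]
    rw [abs_le] at h1 ⊢
    have h2 : |(a - p) * (a + p)| ≤ 2 * ε * 2 := by
      rw [abs_mul]
      gcongr
      · exact abs_le.2 h1
      · rw [abs_of_nonneg (by linarith)]; linarith
    rw [abs_le] at h2
    constructor <;> nlinarith

/-- By Jensen, `E d⁴ ≥ (E d)⁴`, which matches the four-cycle bound in the limit. -/
theorem tendsto_integral_quarticDefect (p : unitInterval) :
    Tendsto (fun n : ℕ ↦ ∫ G, quarticDefect G ∂(SimpleGraph.binomialRandom (Fin n) p)) atTop
      (𝓝 0) := by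
  have hlim : Tendsto (fun n : ℕ ↦ (p : ℝ) ^ 4 + 2 / n - (p * (1 - 1 / n)) ^ 4) atTop (𝓝 0) := by
    have h := ((tendsto_const_div_atTop_nhds_zero_nat (2 : ℝ)).const_add ((p : ℝ) ^ 4)).sub
      ((((tendsto_const_div_atTop_nhds_zero_nat (1 : ℝ)).const_sub 1).const_mul (p : ℝ)).pow 4)
    simpa using h
  refine squeeze_zero' (.of_forall fun n ↦ integral_nonneg quarticDefect_nonneg) ?_ hlim
  filter_upwards [eventually_gt_atTop 0] with n hn
  unfold quarticDefect
  rw [integral_sub .of_finite .of_finite]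
  refine sub_le_sub (integral_sum_singularSpectrum_pow_four_le p hn) ?_
  rw [← integral_edgeDensity p hn]
  exact (Even.convexOn_pow (by decide : Even 4)).map_integral_le (by fun_prop) isClosed_univ
    (.of_forall fun _ ↦ Set.mem_univ _) .of_finite .of_finite

/-- Expand the square and use `E d² ≤ √(E d⁴)`, with `d⁴` at most the spectral fourth moment; no
separate variance computation is needed. -/
theorem tendsto_integral_edgeDensity_sub_sq (p : unitInterval) :
    Tendsto (fun n : ℕ ↦ ∫ G, (edgeDensity G - p) ^ 2 ∂(SimpleGraph.binomialRandom (Fin n) p))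
      atTop (𝓝 0) := by
  have hlim : Tendsto (fun n : ℕ ↦ √((p : ℝ) ^ 4 + 2 / n) - 2 * p * (p * (1 - 1 / n)) + p ^ 2)
      atTop (𝓝 0) := by
    have h1 := ((tendsto_const_div_atTop_nhds_zero_nat (2 : ℝ)).const_add ((p : ℝ) ^ 4)).sqrt
    have h2 := ((((tendsto_const_div_atTop_nhds_zero_nat (1 : ℝ)).const_sub 1).const_mul
      (p : ℝ)).const_mul (2 * (p : ℝ)))
    have h3 : √((p : ℝ) ^ 4 + 0) - 2 * p * (p * (1 - 0)) + p ^ 2 = 0 := by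
      rw [add_zero, show (p : ℝ) ^ 4 = (p ^ 2) ^ 2 by ring, Real.sqrt_sq (sq_nonneg _)]
      ring
    have h4 := (h1.sub h2).add_const ((p : ℝ) ^ 2)
    rwa [h3] at h4
  refine squeeze_zero' (.of_forall fun n ↦ integral_nonneg fun _ ↦ sq_nonneg _) ?_ hlim
  filter_upwards [eventually_gt_atTop 0] with n hn
  simp only [sub_sq]
  rw [integral_add .of_finite .of_finite, integral_sub .of_finite .of_finite]
  have h1 : ∫ G, 2 * edgeDensity G * (p : ℝ) ∂(SimpleGraph.binomialRandom (Fin n) p) =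
      2 * p * (p * (1 - 1 / n)) := by
    rw [integral_mul_const, integral_const_mul, integral_edgeDensity p hn]; ring
  have h2 : ∫ G, edgeDensity G ^ 2 ∂(SimpleGraph.binomialRandom (Fin n) p) ≤
      √((p : ℝ) ^ 4 + 2 / n) := by
    refine Real.le_sqrt_of_sq_le ?_
    have h := (Even.convexOn_pow (by decide : Even 2)).map_integral_le
      (μ := SimpleGraph.binomialRandom (Fin n) p) (f := fun G ↦ edgeDensity G ^ 2) (by fun_prop)
      isClosed_univ (.of_forall fun _ ↦ Set.mem_univ _) .of_finite .of_finite
    refine h.trans (le_trans (integral_mono .of_finite .of_finite fun G ↦ ?_)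
      (integral_sum_singularSpectrum_pow_four_le p hn))
    have := quarticDefect_nonneg G
    unfold quarticDefect at this
    simp only [← pow_mul]
    norm_num
    linarith
  rw [h1]
  simp only [integral_const, probReal_univ, smul_eq_mul, one_mul]
  gcongr

theorem tendsto_integral_of_tendsto_on_quasirandom (p : unitInterval)
    (f : (n : ℕ) → SimpleGraph (Fin n) → ℂ) (L : ℂ) (hf : ∀ n G, ‖f n G‖ ≤ 1) (hL : ‖L‖ ≤ 1)
    (h : ∀ η > 0, ∃ ε > 0, ∀ n > 0, ∀ G : SimpleGraph (Fin n), quarticDefect G ≤ ε →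
      |edgeDensity G - p| ≤ ε → ‖f n G - L‖ ≤ η) :
    Tendsto (fun n ↦ ∫ G, f n G ∂(SimpleGraph.binomialRandom (Fin n) p)) atTop (𝓝 L) := by
  rw [Metric.tendsto_atTop']
  intro η hη
  obtain ⟨ε, hε, hε'⟩ := h (η / 2) (by positivity)
  have hlim := (((tendsto_integral_quarticDefect p).div_const ε).add
    ((tendsto_integral_edgeDensity_sub_sq p).div_const (ε ^ 2))).const_mul 2
  simp only [zero_div, add_zero, mul_zero] at hlim
  obtain ⟨N, hN⟩ := eventually_atTop.1 (hlim.eventually (gt_mem_nhds (half_pos hη)))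
  refine ⟨N, fun n hn ↦ ?_⟩
  have hn0 : 0 < n := by omega
  have hN' := hN n hn.le
  rw [dist_eq_norm]
  -- Markov and Chebyshev in pointwise form: for a bad graph one of the ratios is at least 1, which
  -- pays for the trivial bound 2.
  have hpt (G : SimpleGraph (Fin n)) : ‖f n G - L‖ ≤
      η / 2 + 2 * (quarticDefect G / ε + (edgeDensity G - p) ^ 2 / ε ^ 2) := by
    have hD := quarticDefect_nonneg G
    have h1 : 0 ≤ quarticDefect G / ε := by positivity
    have h2 : 0 ≤ (edgeDensity G - p) ^ 2 / ε ^ 2 := by positivity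
    have h3 : ‖f n G - L‖ ≤ 2 := (norm_sub_le _ _).trans (by linarith [hf n G])
    by_cases hb : quarticDefect G ≤ ε
    · by_cases hc : |edgeDensity G - p| ≤ ε
      · linarith [hε' n hn0 G hb hc]
      · have : 1 ≤ (edgeDensity G - p) ^ 2 / ε ^ 2 := by
          rw [one_le_div (by positivity), ← sq_abs (edgeDensity G - p)]
          exact pow_le_pow_left₀ hε.le (not_le.1 hc).le 2
        linarith
    · have : 1 ≤ quarticDefect G / ε := by
        rw [one_le_div hε]; exact (not_le.1 hb).le
      linarith
  calc ‖(∫ G, f n G ∂(SimpleGraph.binomialRandom (Fin n) p)) - L‖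
      = ‖∫ G, (f n G - L) ∂(SimpleGraph.binomialRandom (Fin n) p)‖ := by
        rw [integral_sub .of_finite .of_finite]; simp
    _ ≤ ∫ G, ‖f n G - L‖ ∂(SimpleGraph.binomialRandom (Fin n) p) := norm_integral_le_integral_norm _
    _ ≤ ∫ G, (η / 2 + 2 * (quarticDefect G / ε + (edgeDensity G - p) ^ 2 / ε ^ 2))
          ∂(SimpleGraph.binomialRandom (Fin n) p) := integral_mono .of_finite .of_finite hpt
    _ = η / 2 + 2 * ((∫ G, quarticDefect G ∂(SimpleGraph.binomialRandom (Fin n) p)) / ε +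
          (∫ G, (edgeDensity G - p) ^ 2 ∂(SimpleGraph.binomialRandom (Fin n) p)) / ε ^ 2) := by
        rw [integral_add .of_finite .of_finite, integral_const_mul,
          integral_add .of_finite .of_finite, integral_div, integral_div, integral_div]
        simp
    _ < η := by linarith

end Concentration

/-! ### Conditioning on the graph and passage to the limit. -/

section Main

open scoped Topology

theorem charFun_map_sum_mul {Ω : Type*} [MeasurableSpace Ω] {P : Measure Ω}
    [IsProbabilityMeasure P] {ι : Type*} [Fintype ι] {Y : ι → Ω → ℝ} {μ : Measure ℝ}
    (hY : ∀ i, HasLaw (Y i) μ P) (hind : iIndepFun Y P) (c : ι → ℝ) (t : ℝ) :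
    charFun (P.map fun ω ↦ ∑ i, c i * Y i ω) t = ∏ i, charFun μ (t * c i) := by
  have hm (i : ι) : AEMeasurable (Y i) P := (hY i).aemeasurable
  have hind' : iIndepFun (fun i ω ↦ c i * Y i ω) P :=
    hind.comp (fun i x ↦ c i * x) fun i ↦ by fun_prop
  rw [(hind'.restrict Finset.univ).charFun_map_fun_finsetSum_eq_prod
    fun i _ ↦ (hm i).const_mul _, Finset.prod_apply]
  refine Finset.prod_congr rfl fun i _ ↦ ?_
  rw [charFun_map_mul_comp (hm i), (hY i).map_eq, mul_comm]

theorem measurable_normalizedSum_singularSpectrum {n : ℕ} :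
    Measurable fun q : SimpleGraph (Fin n) × (Fin n → ℝ) ↦
      normalizedSum (singularSpectrum q.1) q.2 := by
  refine measurable_from_prod_countable_right fun G ↦ ?_
  unfold normalizedSum
  fun_prop

theorem aemeasurable_normalizedSum_singularSpectrum {Ω : Type*} [MeasurableSpace Ω]
    {P : Measure Ω} {n : ℕ} {G : Ω → SimpleGraph (Fin n)} {Y : Fin n → Ω → ℝ}
    (hG : AEMeasurable G P) (hY : AEMeasurable (fun ω i ↦ Y i ω) P) :
    AEMeasurable (fun ω ↦ normalizedSum (singularSpectrum (G ω)) fun i ↦ Y i ω) P :=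
  Measurable.comp_aemeasurable (f := fun ω ↦ (G ω, fun i ↦ Y i ω))
    (g := fun q : SimpleGraph (Fin n) × (Fin n → ℝ) ↦ normalizedSum (singularSpectrum q.1) q.2)
    measurable_normalizedSum_singularSpectrum (hG.prodMk hY)

/-- Independence makes the joint law a product, so Fubini lets the graph be fixed first; the inner
integral then factorises. -/
theorem charFun_normalizedSum_singularSpectrum {Ω : Type*} [MeasurableSpace Ω] {P : Measure Ω}
    [IsProbabilityMeasure P] {n : ℕ} {G : Ω → SimpleGraph (Fin n)} {Y : Fin n → Ω → ℝ}
    {μ : Measure ℝ} {ν : Measure (SimpleGraph (Fin n))} (hG : HasLaw G ν P)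
    (hY : ∀ i, HasLaw (Y i) μ P) (hind : iIndepFun Y P)
    (hGY : IndepFun G (fun ω i ↦ Y i ω) P) (t : ℝ) :
    charFun (P.map fun ω ↦ normalizedSum (singularSpectrum (G ω)) fun i ↦ Y i ω) t =
      ∫ g, ∏ i, charFun μ (t * (singularSpectrum g i / n)) ∂ν := by
  have hmG := hG.aemeasurable
  have hmY : AEMeasurable (fun ω i ↦ Y i ω) P := aemeasurable_pi_lambda _ fun i ↦ (hY i).aemeasurable
  have : IsProbabilityMeasure (P.map G) := Measure.isProbabilityMeasure_map hmG
  have : IsProbabilityMeasure (P.map fun ω i ↦ Y i ω) := Measure.isProbabilityMeasure_map hmY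
  have hprod := (indepFun_iff_map_prod_eq_prod_map_map hmG hmY).1 hGY
  have hmexp : Measurable fun q : SimpleGraph (Fin n) × (Fin n → ℝ) ↦
      Complex.exp (t * normalizedSum (singularSpectrum q.1) q.2 * Complex.I) := by
    have := measurable_normalizedSum_singularSpectrum (n := n)
    fun_prop
  have hmsum : AEMeasurable
      (fun ω ↦ normalizedSum (singularSpectrum (G ω)) fun i ↦ Y i ω) P :=
    aemeasurable_normalizedSum_singularSpectrum hmG hmY
  have hint : Integrable (fun q : SimpleGraph (Fin n) × (Fin n → ℝ) ↦
      Complex.exp (t * normalizedSum (singularSpectrum q.1) q.2 * Complex.I))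
      ((P.map G).prod (P.map fun ω i ↦ Y i ω)) := by
    refine (integrable_const (1 : ℝ)).mono' hmexp.aestronglyMeasurable (.of_forall fun q ↦ ?_)
    rw [← Complex.ofReal_mul, Complex.norm_exp_ofReal_mul_I]
  have hmap := integral_map (hmG.prodMk hmY) hmexp.aestronglyMeasurable
  rw [hprod, integral_prod _ hint] at hmap
  rw [charFun_apply_real, integral_map hmsum (by fun_prop), ← hmap, hG.map_eq]
  refine integral_congr_ae (.of_forall fun g ↦ ?_)
  simp only
  have hmg : Measurable fun y : Fin n → ℝ ↦ ∑ i, singularSpectrum g i / n * y i := by fun_prop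
  have hns (y : Fin n → ℝ) : normalizedSum (singularSpectrum g) y =
      ∑ i, singularSpectrum g i / n * y i := by
    rw [normalizedSum, Finset.mul_sum]
    exact Finset.sum_congr rfl fun i _ ↦ by ring
  rw [← charFun_map_sum_mul hY hind, charFun_apply_real]
  simp only [hns]
  have hmgY : AEMeasurable (fun ω ↦ ∑ i, singularSpectrum g i / n * Y i ω) P :=
    hmg.comp_aemeasurable hmY
  have hmexpg : Measurable fun y : Fin n → ℝ ↦
      Complex.exp (t * ((∑ i, singularSpectrum g i / n * y i : ℝ) : ℂ) * Complex.I) := by fun_prop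
  rw [integral_map hmgY (by fun_prop), integral_map hmY hmexpg.aestronglyMeasurable]

theorem IsSubgaussian.memLp_two {Ω : Type*} [MeasurableSpace Ω] {X : Ω → ℝ} {μ : Measure Ω}
    (hX : IsSubgaussian X μ) : MemLp X 2 μ := by
  refine ⟨hX.1.aestronglyMeasurable, ?_⟩
  have h : eLpNorm X (ENNReal.ofReal 2) μ / ENNReal.ofReal (Real.sqrt 2) < ⊤ :=
    (le_iSup₂ (f := fun (q : ℝ) (_ : 1 ≤ q) ↦
      eLpNorm X (ENNReal.ofReal q) μ / ENNReal.ofReal (Real.sqrt q)) 2 (by norm_num)).trans_lt hX.2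
  rw [lt_top_iff_ne_top, ENNReal.ofReal_ofNat] at h
  by_contra hc
  rw [not_lt, top_le_iff] at hc
  exact h (by rw [hc, ENNReal.top_div_of_ne_top ENNReal.ofReal_ne_top])

theorem tendsto_integral_prod_charFun_singularSpectrum (p : unitInterval) {μ : Measure ℝ}
    [IsProbabilityMeasure μ] {σ : ℝ}
    (hμ : (fun t : ℝ ↦ charFun μ t - Complex.exp (-(σ ^ 2 * t ^ 2 / 2))) =o[𝓝 0]
      fun t ↦ t ^ 2) (t : ℝ) :
    Tendsto (fun n : ℕ ↦ ∫ G, ∏ i, charFun μ (t * (singularSpectrum G i / n))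
      ∂(SimpleGraph.binomialRandom (Fin n) p)) atTop
      (𝓝 (charFun μ (t * p) * Complex.exp (-(σ ^ 2 * t ^ 2 * (p * (1 - p) : ℝ) / 2)))) := by
  have hp0 : (0 : ℝ) ≤ p := p.2.1
  have hp1 : (p : ℝ) ≤ 1 := p.2.2
  refine tendsto_integral_of_tendsto_on_quasirandom p _ _ (fun n G ↦ ?_) ?_ fun η hη ↦ ?_
  · rw [norm_prod]
    exact Finset.prod_le_one (fun _ _ ↦ norm_nonneg _) fun _ _ ↦ norm_charFun_le_one _
  · rw [norm_mul]
    refine mul_le_one₀ (norm_charFun_le_one _) (norm_nonneg _) ?_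
    rw [Complex.norm_exp, Real.exp_le_one_iff]
    norm_cast
    have h1 : 0 ≤ 1 - (p : ℝ) := by linarith
    have : 0 ≤ σ ^ 2 * t ^ 2 * (p * (1 - p)) / 2 := by positivity
    linarith
  · obtain ⟨ε, hε, h⟩ := exists_norm_prod_charFun_sub_le hμ t p (p * (1 - p)) hη
    -- The 5 absorbs the largest constant in `spectrum_close_of_quarticDefect_le`; the fourth power
    -- matches its hypothesis on the defect.
    refine ⟨min ((ε / 5) ^ 4) (ε / 5), by positivity, fun n hn G hD hd ↦ ?_⟩
    obtain ⟨h1, h2, h3⟩ := spectrum_close_of_quarticDefect_le G hn hp0 hp1 (ε := ε / 5)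
      (by positivity) (hD.trans (min_le_left _ _)) (hd.trans (min_le_right _ _))
    exact h _ ⟨0, hn⟩ (by linarith) (fun i hi ↦ (h2 i hi).trans (by linarith)) (by linarith)

end Main

theorem theorem3
    -- the edge probability, `0 < p < 1`
    (p : unitInterval) (hp0 : p ≠ 0) (hp1 : p ≠ 1)
    -- the sub-gaussian variable `X`, centered with variance `σ²`, and the normal variable `N`
    {Ω' : Type*} [MeasurableSpace Ω'] (P' : Measure Ω') [IsProbabilityMeasure P']
    (X N : Ω' → ℝ) (σ : ℝ)
    (hX : IsSubgaussian X P')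
    (hmean : ∫ ω, X ω ∂P' = 0)
    (hvar : variance X P' = σ ^ 2)
    (hN : HasLaw N (gaussianReal 0 (Real.toNNReal ((p : ℝ) * (1 - (p : ℝ)) * σ ^ 2))) P')
    (hXN : IndepFun (fun ω => (p : ℝ) * X ω) N P')
    -- for each `n`: a probability space with a `G(n, p)` random graph and an independent family
    -- of `n` i.i.d. copies of `X`
    {Ω : ℕ → Type*} [∀ n, MeasurableSpace (Ω n)]
    (P : (n : ℕ) → Measure (Ω n)) [∀ n, IsProbabilityMeasure (P n)]
    (G : (n : ℕ) → Ω n → SimpleGraph (Fin n))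
    (Y : (n : ℕ) → Fin n → Ω n → ℝ)
    (hG : ∀ n, HasLaw (G n) (SimpleGraph.binomialRandom (Fin n) p) (P n))
    (hYX : ∀ n i, IdentDistrib (Y n i) X (P n) P')
    (hY : ∀ n, iIndepFun (Y n) (P n))
    (hGY : ∀ n, IndepFun (G n) (fun ω i => Y n i ω) (P n)) :
    TendstoInDistribution
      (fun n ω => normalizedSum (singularSpectrum (G n ω)) (fun i => Y n i ω))
      atTop (fun ω => (p : ℝ) * X ω + N ω) P P' := by
  have hL2 := hX.memLp_two
  have hmX : AEMeasurable X P' := hX.1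
  have hmN := hN.aemeasurable
  have hmG (n : ℕ) : AEMeasurable (G n) (P n) := (hG n).aemeasurable
  have hmY (n : ℕ) : AEMeasurable (fun ω i ↦ Y n i ω) (P n) :=
    aemeasurable_pi_lambda _ fun i ↦ (hYX n i).aemeasurable_fst
  have : IsProbabilityMeasure (P'.map X) := Measure.isProbabilityMeasure_map hmX
  have hsq : ∫ ω, X ω ^ 2 ∂P' = σ ^ 2 := by
    rw [← hvar, variance_of_integral_eq_zero hmX hmean]
  refine ⟨fun n ↦ aemeasurable_normalizedSum_singularSpectrum (hmG n) (hmY n), by fun_prop, ?_⟩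
  refine ProbabilityMeasure.tendsto_iff_tendsto_charFun.2 fun t ↦ ?_
  simp only [ProbabilityMeasure.coe_mk]
  have hv : 0 ≤ (p : ℝ) * (1 - p) * σ ^ 2 :=
    mul_nonneg (mul_nonneg p.2.1 (by linarith [p.2.2])) (sq_nonneg σ)
  have hlim : charFun (P'.map fun ω ↦ (p : ℝ) * X ω + N ω) t =
      charFun (P'.map X) (t * p) *
        Complex.exp (-(σ ^ 2 * t ^ 2 * ((p : ℝ) * (1 - (p : ℝ)) : ℝ) / 2)) := by
    rw [hXN.charFun_map_fun_add_eq_mul (hmX.const_mul _) hmN, Pi.mul_apply,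
      charFun_map_mul_comp hmX, hN.map_eq, charFun_gaussianReal, Real.coe_toNNReal _ hv, mul_comm t]
    congr 2
    push_cast
    ring
  rw [hlim]
  refine (tendsto_integral_prod_charFun_singularSpectrum p
    (charFun_sub_exp_isLittleO hL2 hmean hsq) t).congr fun n ↦ ?_
  exact (charFun_normalizedSum_singularSpectrum (hG n)
    (fun i ↦ ⟨(hYX n i).aemeasurable_fst, (hYX n i).map_eq⟩) (hY n) (hGY n) t).symm
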